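/- All rings are commutative with $1\neq 0$, and $n$ is a positive integer. For a ring $A$ let $\mathfrak{J}(A)$ denote the set of ideals of $A$. Given a function $\phi:\mathfrak{J}(A)\to\mathfrak{J}(A)\cup\{\emptyset\}$, a proper ideal $I$ of $A$ is called $\phi$-$n$-absorbing primary if, whenever $a_1,\dots,a_{n+1}\in A$ and $a_1a_2\cdots a_{n+1}\in I\setminus\phi(I)$, either $a_1a_2\cdots a_n\in I$ or $\prod_{1\le j\le n+1,\ j\neq i}a_j\in\sqrt{I}$ for some $1\le i\le n$. Let $T$ be an $R$-algebra. The content of $f\in T$ is the ideal $c(f)=\bigcap\{I : I \text{ is an ideal of } R \text{ and } f\in IT\}$ of $R$. One calls $T$ a content $R$-algebra if (1) $f\in c(f)T$ for all $f\in T$; (2) $c(rf)=r\,c(f)$ for all $r\in R$, $f\in T$, and $c(1_T)=R$; (3) for all $f,g\in T$ there is an integer $m\geq 1$ such that $c(f)^m c(g)=c(f)^{m-1}c(fg)$. A Prüfer domain is an integral domain in which every nonzero finitely generated ideal is invertible. Theorem. Let $R$ be a Prüfer domain, $T$ a content $R$-algebra, and $\iota:R\to T$ the structure homomorphism. Let $\phi_T:\mathfrak{J}(T)\to\mathfrak{J}(T)\cup\{\emptyset\}$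 be any function, and define $\phi_R:\mathfrak{J}(R)\to\mathfrak{J}(R)\cup\{\emptyset\}$ by $\phi_R(I)=\iota^{-1}(\phi_T(IT))$ (so $\phi_R(I)=\emptyset$ if $\phi_T(IT)=\emptyset$). Then for every ideal $I$ of $R$, $I$ is a $\phi_R$-$n$-absorbing primary ideal of $R$ if and only if $IT$ is a $\phi_T$-$n$-absorbing primary ideal of $T$. -/

import Mathlib

/-- A Prüfer domain: an integral domain in which every nonzero finitely generated ideal is
invertible (as a fractional ideal of the field of fractions). -/
def IsPruferDomain (R : Type*) [CommRing R] : Prop :=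
  IsDomain R ∧ ∀ I : Ideal R, I.FG → I ≠ ⊥ →
    IsUnit (I : FractionalIdeal (nonZeroDivisors R) (FractionRing R))

/-- The content `c(f)` of an element `f` of an `R`-algebra `T`: the intersection of all ideals `I`
of `R` such that `f ∈ IT`. -/
def algebraContent (R : Type*) {T : Type*} [CommRing R] [CommRing T] [Algebra R T] (f : T) :
    Ideal R :=
  sInf {I : Ideal R | f ∈ I.map (algebraMap R T)}

/-- `T` is a content `R`-algebra. In the Dedekind-Mertens formula the exponents are a positive
integer `m + 1` and its predecessor `m`. -/
structure IsContentAlgebra (R T : Type*) [CommRing R] [CommRing T] [Algebra R T] : Prop where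
  mem_map_content : ∀ f : T, f ∈ (algebraContent R f).map (algebraMap R T)
  content_smul : ∀ (r : R) (f : T),
    algebraContent R (r • f) = Ideal.span {r} * algebraContent R f
  content_one : algebraContent R (1 : T) = ⊤
  dedekind_mertens : ∀ f g : T, ∃ m : ℕ,
    algebraContent R f ^ (m + 1) * algebraContent R g =
      algebraContent R f ^ m * algebraContent R (f * g)

/-- An element of `𝔍(R) ∪ {∅}`: an ideal of `R`, or (as `none`) the empty set. -/
abbrev IdealOrEmpty (R : Type*) [CommRing R] : Type _ := Option (Ideal R)

/-- The underlying subset of `R` of an element of `𝔍(R) ∪ {∅}`. -/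
def IdealOrEmpty.toSet {R : Type*} [CommRing R] : IdealOrEmpty R → Set R
  | none => ∅
  | some J => (J : Set R)

/-- `I` is a `φ`-`n`-absorbing primary ideal: `I` is proper, and `a₁ ⋯ aₙ₊₁ ∈ I \ φ(I)` implies
`a₁ ⋯ aₙ ∈ I` or `a₁ ⋯ âᵢ ⋯ aₙ₊₁ ∈ √I` for some `1 ≤ i ≤ n`. -/
def IsPhiAbsorbingPrimary {R : Type*} [CommRing R] (φ : Ideal R → IdealOrEmpty R) (n : ℕ)
    (I : Ideal R) : Prop :=
  I ≠ ⊤ ∧ ∀ a : Fin (n + 1) → R, ∏ j, a j ∈ (I : Set R) \ (φ I).toSet →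
    ∏ j : Fin n, a j.castSucc ∈ I ∨
      ∃ i : Fin n, ∏ j ∈ Finset.univ.erase i.castSucc, a j ∈ I.radical

/-- The function `φ_R(I) = φ_T(Iᵉ)ᶜ` (and `φ_R(I) = ∅` if `φ_T(Iᵉ) = ∅`) on ideals of `R` that a
function `φ_T` on ideals of an `R`-algebra `T` induces. -/
def inducedPhi (R : Type*) {T : Type*} [CommRing R] [CommRing T] [Algebra R T]
    (φT : Ideal T → IdealOrEmpty T) : Ideal R → IdealOrEmpty R :=
  fun I => (φT (I.map (algebraMap R T))).map (Ideal.comap (algebraMap R T))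

section Content

variable {R T : Type*} [CommRing R] [CommRing T] [Algebra R T]

/-! Two facts carry the theorem. First, `f ∈ IT` iff `c(f) ≤ I`, and over a Prüfer domain `c` is
multiplicative, so `∏ f j ∈ KT` iff `∏ c(f j) ≤ K`. Since `IT` contracts to `I`, descent from `IT`
to `I` is immediate. Conversely, a counterexample `f` for `IT` gives finitely generated ideals `c(f
j)` satisfying finitely many non-inclusions. Second, elements `a j ∈ c(f j)` can be chosen to
satisfy them all at once (`exists_mem_prod_notMem`), because each non-inclusion is detected at one
maximal ideal and finitely generated ideals are principal near finitely many maximal ideals. Then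
`a` is a counterexample for `I`. -/

theorem algebraContent_le {f : T} {I : Ideal R} (h : f ∈ I.map (algebraMap R T)) :
    algebraContent R f ≤ I :=
  sInf_le h

theorem IsContentAlgebra.algebraContent_le_iff (hT : IsContentAlgebra R T) {f : T} {I : Ideal R} :
    algebraContent R f ≤ I ↔ f ∈ I.map (algebraMap R T) :=
  ⟨fun h => Ideal.map_mono h (hT.mem_map_content f), algebraContent_le⟩

theorem IsContentAlgebra.algebraContent_algebraMap (hT : IsContentAlgebra R T) (r : R) :
    algebraContent R (algebraMap R T r) = Ideal.span {r} := by
  rw [Algebra.algebraMap_eq_smul_one, hT.content_smul, hT.content_one, Ideal.mul_top]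

theorem IsContentAlgebra.algebraMap_mem_map_iff (hT : IsContentAlgebra R T) {r : R}
    {I : Ideal R} : algebraMap R T r ∈ I.map (algebraMap R T) ↔ r ∈ I := by
  rw [← hT.algebraContent_le_iff, hT.algebraContent_algebraMap, Ideal.span_singleton_le_iff_mem]

theorem IsContentAlgebra.map_eq_top_iff (hT : IsContentAlgebra R T) {I : Ideal R} :
    I.map (algebraMap R T) = ⊤ ↔ I = ⊤ := by
  rw [Ideal.eq_top_iff_one, Ideal.eq_top_iff_one, ← hT.algebraMap_mem_map_iff, map_one]

theorem IsContentAlgebra.algebraMap_mem_radical_iff (hT : IsContentAlgebra R T) {r : R}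
    {I : Ideal R} : algebraMap R T r ∈ (I.map (algebraMap R T)).radical ↔ r ∈ I.radical := by
  simp only [Ideal.mem_radical_iff, ← map_pow, hT.algebraMap_mem_map_iff]

/-- An element of an extended ideal lies in the extension of a finitely generated subideal. -/
theorem Ideal.exists_fg_le_mem_map {I : Ideal R} {f : T} (hf : f ∈ I.map (algebraMap R T)) :
    ∃ J : Ideal R, J.FG ∧ J ≤ I ∧ f ∈ J.map (algebraMap R T) := by
  refine Submodule.span_induction (p := fun f _ =>
    ∃ J : Ideal R, J.FG ∧ J ≤ I ∧ f ∈ J.map (algebraMap R T)) ?_ ?_ ?_ ?_ hf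
  · rintro _ ⟨r, hr, rfl⟩
    exact ⟨Ideal.span {r}, Submodule.fg_span_singleton r, by simpa using hr,
      Ideal.mem_map_of_mem _ (Ideal.mem_span_singleton_self r)⟩
  · exact ⟨⊥, Submodule.fg_bot, bot_le, zero_mem _⟩
  · rintro x y _ _ ⟨J, hJ, hJI, hx⟩ ⟨K, hK, hKI, hy⟩
    exact ⟨J ⊔ K, Submodule.FG.sup hJ hK, sup_le hJI hKI, add_mem (Ideal.map_mono le_sup_left hx)
      (Ideal.map_mono le_sup_right hy)⟩
  · rintro t x _ ⟨J, hJ, hJI, hx⟩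
    exact ⟨J, hJ, hJI, Ideal.mul_mem_left _ t hx⟩

/-- Minimality of `c(f)` forces equality with any finitely generated `J ≤ c(f)` such that `f ∈ JT`.
-/
theorem IsContentAlgebra.algebraContent_fg (hT : IsContentAlgebra R T) (f : T) :
    (algebraContent R f).FG := by
  obtain ⟨J, hJ, hJf, hf⟩ := Ideal.exists_fg_le_mem_map (hT.mem_map_content f)
  rwa [le_antisymm (algebraContent_le hf) hJf]

theorem algebraContent_zero : algebraContent R (0 : T) = ⊥ :=
  le_bot_iff.mp (algebraContent_le (zero_mem _))

end Content

section Prufer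

variable {R : Type*} [CommRing R]

theorem IsPruferDomain.mul_le_mul_left_iff (hR : IsPruferDomain R) {A B C : Ideal R}
    (hA : A.FG) (hA0 : A ≠ ⊥) : A * B ≤ A * C ↔ B ≤ C := by
  have := hR.1
  refine ⟨fun h => ?_, fun h => Ideal.mul_mono_right h⟩
  obtain ⟨u, hu⟩ := hR.2 A hA hA0
  rw [← FractionalIdeal.coeIdeal_le_coeIdeal (FractionRing R), FractionalIdeal.coeIdeal_mul,
    FractionalIdeal.coeIdeal_mul, ← hu] at h
  have h' := mul_le_mul_right h (↑u⁻¹ : FractionalIdeal (nonZeroDivisors R) (FractionRing R))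
  rwa [Units.inv_mul_cancel_left, Units.inv_mul_cancel_left,
    FractionalIdeal.coeIdeal_le_coeIdeal] at h'

theorem IsPruferDomain.mul_left_cancel (hR : IsPruferDomain R) {A B C : Ideal R}
    (hA : A.FG) (hA0 : A ≠ ⊥) (h : A * B = A * C) : B = C :=
  le_antisymm ((hR.mul_le_mul_left_iff hA hA0).mp h.le) ((hR.mul_le_mul_left_iff hA hA0).mp h.ge)

theorem IsPruferDomain.exists_mul_eq_of_le (hR : IsPruferDomain R) {A B : Ideal R}
    (hA : A.FG) (hA0 : A ≠ ⊥) (h : B ≤ A) : ∃ C, A * C = B := by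
  have := hR.1
  obtain ⟨u, hu⟩ := hR.2 A hA hA0
  -- `A⁻¹B` is integral, so it serves as `C`.
  have hle : (↑u⁻¹ : FractionalIdeal (nonZeroDivisors R) (FractionRing R)) * B ≤ 1 := by
    rw [← Units.inv_mul u, hu]
    exact mul_le_mul_right ((FractionalIdeal.coeIdeal_le_coeIdeal (FractionRing R)).mpr h) _
  obtain ⟨C, hC⟩ := FractionalIdeal.le_one_iff_exists_coeIdeal.mp hle
  refine ⟨C, FractionalIdeal.coeIdeal_injective (K := FractionRing R) ?_⟩
  simp only [FractionalIdeal.coeIdeal_mul]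
  rw [hC, ← hu, Units.mul_inv_cancel_left]

/-- A finitely generated nonzero ideal `A` of a Prüfer domain is not covered by the products `A * M`
with finitely many maximal ideals `M`. -/
theorem IsPruferDomain.exists_mem_forall_notMem_mul (hR : IsPruferDomain R) {A : Ideal R}
    (hA : A.FG) (hA0 : A ≠ ⊥) (S : Finset (Ideal R)) (hS : ∀ M ∈ S, M.IsMaximal) :
    ∃ a ∈ A, ∀ M ∈ S, a ∉ A * M := by
  classical
  -- As in the Chinese remainder theorem: `x M` avoids `A * M` but lies in `A * N` for every other
  -- `N ∈ S`, so the sum of all `x N` avoids each `A * M`.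
  have key : ∀ M ∈ S, ∃ x : R, x ∈ A * ∏ N ∈ S.erase M, N ∧ x ∉ A * M := by
    intro M hM
    refine SetLike.not_le_iff_exists.mp fun h => ?_
    have h1 := (hR.mul_le_mul_left_iff hA hA0).mp h
    obtain ⟨N, hN, hNM⟩ := (Ideal.IsPrime.prod_le (hS M hM).isPrime).mp h1
    have hN' := Finset.mem_erase.mp hN
    exact hN'.1 ((hS N hN'.2).eq_of_le (hS M hM).ne_top hNM)
  choose! x hx hxM using key
  refine ⟨∑ N ∈ S, x N, sum_mem fun N hN => Ideal.mul_le_left (hx N hN), fun M hM h => ?_⟩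
  have hrest : ∑ N ∈ S.erase M, x N ∈ A * M := by
    refine sum_mem fun N hN => ?_
    have hN' := Finset.mem_erase.mp hN
    have hle : ∏ L ∈ S.erase N, L ≤ M :=
      Ideal.le_of_dvd (Finset.dvd_prod_of_mem (fun L : Ideal R => L)
        (Finset.mem_erase.mpr ⟨hN'.1.symm, hM⟩))
    exact Ideal.mul_mono_right hle (hx N hN'.2)
  rw [← Finset.add_sum_erase _ _ hM] at h
  exact hxM M hM ((Ideal.add_mem_iff_left _ hrest).mp h)

/-- A finitely generated ideal `A` of a Prüfer domain contains an element which generates `A`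
locally at each of finitely many given maximal ideals. -/
theorem IsPruferDomain.exists_mul_eq_span_singleton (hR : IsPruferDomain R) {A : Ideal R}
    (hA : A.FG) (S : Finset (Ideal R)) (hS : ∀ M ∈ S, M.IsMaximal) :
    ∃ (a : R) (C : Ideal R), A * C = Ideal.span {a} ∧ ∀ M ∈ S, ¬ C ≤ M := by
  by_cases hA0 : A = ⊥
  · exact ⟨0, ⊤, by simp [hA0], fun M hM h => (hS M hM).ne_top (top_le_iff.mp h)⟩
  obtain ⟨a, haA, ha⟩ := hR.exists_mem_forall_notMem_mul hA hA0 S hS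
  obtain ⟨C, hC⟩ := hR.exists_mul_eq_of_le hA hA0 ((Ideal.span_singleton_le_iff_mem A).mpr haA)
  refine ⟨a, C, hC, fun M hM h => ha M hM ?_⟩
  exact (Ideal.span_singleton_le_iff_mem (A * M)).mp (hC.ge.trans (Ideal.mul_mono_right h))

/-- In a Prüfer domain, finitely many non-inclusions `∏ i ∈ s, A i ≰ K` between products of
finitely generated ideals and ideals are witnessed simultaneously by elements `a i ∈ A i`. -/
theorem IsPruferDomain.exists_mem_prod_notMem (hR : IsPruferDomain R) {ι : Type*}
    {A : ι → Ideal R} (hA : ∀ i, (A i).FG) {P : Set (Finset ι × Ideal R)} (hP : P.Finite)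
    (h : ∀ p ∈ P, ¬ ∏ i ∈ p.1, A i ≤ p.2) :
    ∃ a : ι → R, (∀ i, a i ∈ A i) ∧ ∀ p ∈ P, ∏ i ∈ p.1, a i ∉ p.2 := by
  classical
  -- `M` is a maximal ideal above the proper colon ideal `(p.2 : ∏ A i)`.
  have hmax : ∀ p ∈ P, ∃ M : Ideal R, M.IsMaximal ∧
      ∀ C : Ideal R, (∏ i ∈ p.1, A i) * C ≤ p.2 → C ≤ M := by
    intro p hp
    have hne : p.2.colon (∏ i ∈ p.1, A i : Ideal R) ≠ ⊤ := by
      intro htop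
      refine h p hp fun x hx => ?_
      have h1 := Submodule.mem_colon.mp ((Ideal.eq_top_iff_one _).mp htop) x hx
      rwa [one_smul] at h1
    obtain ⟨M, hM, hle⟩ := Ideal.exists_le_maximal _ hne
    refine ⟨M, hM, fun C hC c hc => hle (Submodule.mem_colon.mpr fun x hx => ?_)⟩
    rw [smul_eq_mul, mul_comm]
    exact hC (Ideal.mul_mem_mul hx hc)
  choose! M hM hMC using hmax
  have hS : ∀ N ∈ hP.toFinset.image M, N.IsMaximal := by
    simp only [Finset.mem_image, Set.Finite.mem_toFinset]
    rintro _ ⟨p, hp, rfl⟩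
    exact hM p hp
  choose a C haC hC using fun i => hR.exists_mul_eq_span_singleton (hA i) _ hS
  refine ⟨a, fun i => ?_, fun p hp hmem => ?_⟩
  · exact (Ideal.span_singleton_le_iff_mem (A i)).mp ((haC i).ge.trans Ideal.mul_le_left)
  -- Otherwise `∏ C i` lies in the colon ideal, hence in `M p`, and by primality so does some `C i`.
  · have hle : (∏ i ∈ p.1, A i) * ∏ i ∈ p.1, C i ≤ p.2 := by
      rw [← Finset.prod_mul_distrib, Finset.prod_congr rfl fun i _ => haC i,
        Ideal.prod_span_singleton]
      exact (Ideal.span_singleton_le_iff_mem p.2).mpr hmem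
    obtain ⟨i, -, hi⟩ := (Ideal.IsPrime.prod_le (hM p hp).isPrime).mp (hMC p hp _ hle)
    exact hC i (M p) (Finset.mem_image_of_mem M (hP.mem_toFinset.mpr hp)) hi

end Prufer

section ContentPrufer

variable {R T : Type*} [CommRing R] [CommRing T] [Algebra R T]

/-- The factor `c(f)^m` in the Dedekind-Mertens formula is finitely generated and, for `f ≠ 0`,
nonzero, so it cancels. -/
theorem IsContentAlgebra.algebraContent_mul (hT : IsContentAlgebra R T) (hR : IsPruferDomain R)
    (f g : T) : algebraContent R (f * g) = algebraContent R f * algebraContent R g := by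
  have := hR.1
  by_cases hf : algebraContent R f = ⊥
  · have hf0 : f = 0 := by simpa [hf] using hT.mem_map_content f
    rw [hf0, zero_mul, algebraContent_zero, Ideal.bot_mul]
  · obtain ⟨m, hm⟩ := hT.dedekind_mertens f g
    rw [pow_succ, mul_assoc] at hm
    exact (hR.mul_left_cancel ((hT.algebraContent_fg f).pow) (pow_ne_zero m hf) hm).symm

theorem IsContentAlgebra.algebraContent_prod (hT : IsContentAlgebra R T) (hR : IsPruferDomain R)
    {ι : Type*} (s : Finset ι) (f : ι → T) :
    algebraContent R (∏ i ∈ s, f i) = ∏ i ∈ s, algebraContent R (f i) :=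
  map_prod (⟨⟨algebraContent R, hT.content_one.trans Ideal.one_eq_top.symm⟩, hT.algebraContent_mul hR⟩ : T →* Ideal R) f s

theorem mem_toSet_inducedPhi_iff (φT : Ideal T → IdealOrEmpty T) (I : Ideal R) (r : R) :
    r ∈ (inducedPhi R φT I).toSet ↔
      algebraMap R T r ∈ (φT (I.map (algebraMap R T))).toSet := by
  unfold inducedPhi
  cases φT (I.map (algebraMap R T)) <;> rfl

theorem IsContentAlgebra.isPhiAbsorbingPrimary_of_map (hT : IsContentAlgebra R T)
    {φT : Ideal T → IdealOrEmpty T} {n : ℕ} {I : Ideal R}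
    (h : IsPhiAbsorbingPrimary φT n (I.map (algebraMap R T))) :
    IsPhiAbsorbingPrimary (inducedPhi R φT) n I := by
  refine ⟨fun hI => h.1 (hT.map_eq_top_iff.mpr hI), fun a ha => ?_⟩
  have h2 := h.2 (fun j => algebraMap R T (a j))
  simp only [← map_prod, hT.algebraMap_mem_map_iff, hT.algebraMap_mem_radical_iff, Set.mem_sdiff,
    SetLike.mem_coe, ← mem_toSet_inducedPhi_iff] at h2
  exact h2 ha

theorem IsContentAlgebra.isPhiAbsorbingPrimary_map (hT : IsContentAlgebra R T)
    (hR : IsPruferDomain R) {φT : Ideal T → IdealOrEmpty T} {n : ℕ} {I : Ideal R}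
    (h : IsPhiAbsorbingPrimary (inducedPhi R φT) n I) :
    IsPhiAbsorbingPrimary φT n (I.map (algebraMap R T)) := by
  refine ⟨fun hI => h.1 (hT.map_eq_top_iff.mp hI), fun f hf => ?_⟩
  by_contra! hcon
  obtain ⟨hcon, hrad⟩ := hcon
  have hprod : ∀ (s : Finset (Fin (n + 1))) (K : Ideal R),
      ∏ j ∈ s, algebraContent R (f j) ≤ K ↔ ∏ j ∈ s, f j ∈ K.map (algebraMap R T) := by
    intro s K
    rw [← hT.algebraContent_prod hR, hT.algebraContent_le_iff]
  obtain ⟨a, ha, haP⟩ := hR.exists_mem_prod_notMem (fun j => hT.algebraContent_fg (f j))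
    -- The last set has at most one element: it is empty when `φ_R(I) = ∅`.
    (P := insert (Finset.univ.map Fin.castSuccEmb, I)
      (Set.range (fun i : Fin n => (Finset.univ.erase i.castSucc, I.radical)) ∪
        Prod.mk Finset.univ '' {J | inducedPhi R φT I = some J}))
    (Set.Finite.insert _ ((Set.finite_range _).union (Set.Finite.image _
      (Set.Subsingleton.finite fun J hJ K hK => Option.some.inj (hJ.symm.trans hK))))) (by
    rintro p (rfl | ⟨i, rfl⟩ | ⟨J, hJ, rfl⟩)
    · rw [hprod, Finset.prod_map]
      exact hcon
    · rw [hprod]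
      exact fun hi => hrad i (Ideal.map_radical_le _ hi)
    · rw [hprod]
      intro hmem
      refine hf.2 ?_
      obtain ⟨K, hK, rfl⟩ := Option.map_eq_some_iff.mp hJ
      rw [hK]
      -- `φ_R(I)T ⊆ φ_T(IT)`, so avoiding `φ_T(IT)` gives the non-inclusion in `φ_R(I)`.
      exact Ideal.map_comap_le hmem)
  have haI : ∏ j, a j ∈ I :=
    (hprod _ _).mpr hf.1 (Ideal.prod_mem_prod fun j _ => ha j)
  have haφ : ∏ j, a j ∉ (inducedPhi R φT I).toSet := by
    intro hmem
    cases hJ : inducedPhi R φT I with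
    | none => rw [hJ] at hmem; exact hmem
    | some J =>
      rw [hJ] at hmem
      exact haP _ (Or.inr (Or.inr ⟨J, hJ, rfl⟩)) hmem
  rcases h.2 a ⟨haI, haφ⟩ with h1 | ⟨i, hi⟩
  · refine haP _ (Or.inl rfl) ?_
    rw [Finset.prod_map]
    exact h1
  · exact haP _ (Or.inr (Or.inl ⟨i, rfl⟩)) hi

end ContentPrufer

theorem mainTheorem9 {R T : Type*} [CommRing R] [CommRing T] [Algebra R T]
    (hR : IsPruferDomain R) (hT : IsContentAlgebra R T)
    (φT : Ideal T → IdealOrEmpty T) (n : ℕ) (hn : 1 ≤ n) (I : Ideal R) :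
    IsPhiAbsorbingPrimary (inducedPhi R φT) n I ↔
      IsPhiAbsorbingPrimary φT n (I.map (algebraMap R T)) :=
  ⟨hT.isPhiAbsorbingPrimary_map hR, hT.isPhiAbsorbingPrimary_of_map⟩
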